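/- Let $K$ be a field of characteristic different from $2$ and $3$. An \emph{$\omega$-Lie algebra} is an anticommutative $K$-algebra $L$ with product $[\cdot,\cdot]$ together with a bilinear form $\omega:L\times L\to K$ such that $$[[x,y],z]+[[z,x],y]+[[y,z],x]=\omega(x,y)z+\omega(z,x)y+\omega(y,z)x\qquad\text{for all }x,y,z\in L.$$ Write $\operatorname{Ker}\omega=\{x\in L:\omega(x,L)=0\}$ and $\operatorname{ad}x:y\mapsto[y,x]$. A Lie algebra is called \emph{almost abelian} with \emph{abelian part} $A$ if it is a semidirect sum $A\oplus Kx$ with $A$ abelian and $\operatorname{ad}x$ acting on $A$ as the identity. Let $L$ be a finite-dimensional $\omega$-Lie algebra over $K$ which is not a Lie algebra. Then at least one of the following holds: (i) $\dim L=3$. (ii) $L$ has a Lie subalgebra $M$ of codimension $1$ such that, for every $v\in L\setminus M$, with $\alpha:M\to K$, $\alpha(x)=\omega(x,v)$, the kernel $\operatorname{Ker}\alpha$ is a subalgebra of codimension $1$ in $M$ and one of the following holds: (a) $M=A\oplus Kx$, $A$ is abelian, $\operatorname{ad}x$ maps $A$ to $A$ (by an arbitrary linear map); $\operatorname{Ker}\alpha=A$;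 (b) $M$ is the direct sum of an abelian Lie algebra $A$ and the two-dimensional Lie algebra $\langle x,y\mid[x,y]=y\rangle$; $\operatorname{Ker}\alpha=A\oplus Kx$; (c) $M=A\oplus Kx\oplus Ky$, $A$ is abelian, $\operatorname{ad}x$ is the identity on $A$, $\operatorname{ad}y$ maps $A$ to $A$ (by an arbitrary linear map), and $[x,y]\in A$; $\operatorname{Ker}\alpha=A\oplus Kx$; (d) $M=A\oplus Kx\oplus Ky$, $A$ is abelian, $\operatorname{ad}x$ is the identity on $A$, $\operatorname{ad}y$ is zero on $A$, and $[x,y]=a+\sigma y$ for some $a\in A$ and $0\neq\sigma\in K$; $\operatorname{Ker}\alpha=A\oplus Kx$. (iii) $\operatorname{Ker}\omega$ is a subalgebra of codimension $2$ in $L$ which is an almost abelian Lie algebra, and for every element $a$ of its abelian part the endomorphism $\operatorname{ad}a$ of $L$ is nilpotent. In all the cases, $L$ has an abelian subalgebra of codimension at most $3$. -/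

import Mathlib

/-! An algebra structure on a vector space `L` is a bilinear map `br : L →ₗ[K] L →ₗ[K] L`,
with `br x y` in the role of `[x, y]`. -/

namespace OmegaLie

variable {K L : Type*} [Field K] [AddCommGroup L] [Module K L]

/-- The algebra `(L, br)` is an `ω`-Lie algebra: it is anticommutative and satisfies the
`ω`-Jacobi identity. (Skew-symmetry of `ω` is not required, it is a consequence in
dimension at least `2`.) -/
structure IsOmegaLieAlgebra (br : L →ₗ[K] L →ₗ[K] L) (ω : L →ₗ[K] L →ₗ[K] K) : Prop where
  bracket_self : ∀ x : L, br x x = 0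
  omega_jacobi : ∀ x y z : L,
    br (br x y) z + br (br z x) y + br (br y z) x = ω x y • z + ω z x • y + ω y z • x

/-- The subspace `S` is a subalgebra. -/
def IsSubalgebra (br : L →ₗ[K] L →ₗ[K] L) (S : Submodule K L) : Prop :=
  ∀ x ∈ S, ∀ y ∈ S, br x y ∈ S

/-- The subspace `S` is an abelian subalgebra: all products of its elements vanish. -/
def IsAbelian (br : L →ₗ[K] L →ₗ[K] L) (S : Submodule K L) : Prop :=
  ∀ x ∈ S, ∀ y ∈ S, br x y = 0

/-- The subspace `S` is a subalgebra which is a Lie algebra under the restricted product. -/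
structure IsLieSubalgebra (br : L →ₗ[K] L →ₗ[K] L) (S : Submodule K L) : Prop where
  isSubalgebra : IsSubalgebra br S
  bracket_self : ∀ x ∈ S, br x x = 0
  jacobi : ∀ x ∈ S, ∀ y ∈ S, ∀ z ∈ S,
    br (br x y) z + br (br z x) y + br (br y z) x = 0

/-- The whole algebra `(L, br)` is a Lie algebra. -/
def IsLieAlgebra (br : L →ₗ[K] L →ₗ[K] L) : Prop :=
  IsLieSubalgebra br ⊤

/-- The adjoint endomorphism `ad x : y ↦ [y, x]`, a right multiplication. -/
def ad (br : L →ₗ[K] L →ₗ[K] L) (x : L) : Module.End K L :=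
  br.flip x

/-- The subspace `S` is an almost abelian Lie algebra with abelian part `A`: it is the
semidirect sum `A ⊕ Kx` with `A` abelian and `ad x` acting on `A` as the identity. -/
def IsAlmostAbelianWithPart (br : L →ₗ[K] L →ₗ[K] L) (S A : Submodule K L) : Prop :=
  IsLieSubalgebra br S ∧ IsAbelian br A ∧
    ∃ x : L, x ∉ A ∧ S = A ⊔ Submodule.span K {x} ∧ ∀ a ∈ A, ad br x a = a

/-- For a subspace `M` and a vector `v`, the kernel of the linear form
`α : M → K`, `α x = ω x v`. -/
def alphaKer (ω : L →ₗ[K] L →ₗ[K] K) (M : Submodule K L) (v : L) : Submodule K L :=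
  M ⊓ LinearMap.ker (ω.flip v)

/-- `M = A ⊕ Kx`, `A` is abelian, `ad x : A → A` is any linear map; `Ker α = A`. -/
def TypeA (br : L →ₗ[K] L →ₗ[K] L) (M kerα : Submodule K L) : Prop :=
  ∃ (A : Submodule K L) (x : L),
    x ∉ A ∧ M = A ⊔ Submodule.span K {x} ∧
    IsAbelian br A ∧ (∀ a ∈ A, ad br x a ∈ A) ∧
    kerα = A

/-- `M` is the direct sum of an abelian Lie algebra `A` and the two-dimensional nonabelian
Lie algebra `⟨x, y | [x, y] = y⟩`; `Ker α = A ⊕ Kx`. -/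
def TypeB (br : L →ₗ[K] L →ₗ[K] L) (M kerα : Submodule K L) : Prop :=
  ∃ (A : Submodule K L) (x y : L),
    x ∉ A ∧ y ∉ A ⊔ Submodule.span K {x} ∧
    M = A ⊔ Submodule.span K {x} ⊔ Submodule.span K {y} ∧
    IsAbelian br A ∧ (∀ a ∈ A, ad br x a = 0) ∧ (∀ a ∈ A, ad br y a = 0) ∧
    br x y = y ∧
    kerα = A ⊔ Submodule.span K {x}

/-- `M = A ⊕ Kx ⊕ Ky`, `A` is abelian, `ad x : A → A` is the identity, `ad y : A → A` is any
linear map, and `[x, y] ∈ A`; `Ker α = A ⊕ Kx`. -/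
def TypeC (br : L →ₗ[K] L →ₗ[K] L) (M kerα : Submodule K L) : Prop :=
  ∃ (A : Submodule K L) (x y : L),
    x ∉ A ∧ y ∉ A ⊔ Submodule.span K {x} ∧
    M = A ⊔ Submodule.span K {x} ⊔ Submodule.span K {y} ∧
    IsAbelian br A ∧ (∀ a ∈ A, ad br x a = a) ∧ (∀ a ∈ A, ad br y a ∈ A) ∧
    br x y ∈ A ∧
    kerα = A ⊔ Submodule.span K {x}

/-- `M = A ⊕ Kx ⊕ Ky`, `A` is abelian, `ad x : A → A` is the identity, `ad y : A → A` is zero,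
`[x, y] = a + σ y` for some `a ∈ A` and `σ ≠ 0`; `Ker α = A ⊕ Kx`. -/
def TypeD (br : L →ₗ[K] L →ₗ[K] L) (M kerα : Submodule K L) : Prop :=
  ∃ (A : Submodule K L) (x y : L),
    x ∉ A ∧ y ∉ A ⊔ Submodule.span K {x} ∧
    M = A ⊔ Submodule.span K {x} ⊔ Submodule.span K {y} ∧
    IsAbelian br A ∧ (∀ a ∈ A, ad br x a = a) ∧ (∀ a ∈ A, ad br y a = 0) ∧
    (∃ a ∈ A, ∃ σ : K, σ ≠ 0 ∧ br x y = a + σ • y) ∧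
    kerα = A ⊔ Submodule.span K {x}

/-- The list of possible structures of a Lie subalgebra `M` of codimension `1`, together with
the kernel of the linear form `α` on it: `Ker α` is a subalgebra of codimension `1` in `M`,
and the pair `(M, Ker α)` is of one of the four explicit types. -/
def IsListed (br : L →ₗ[K] L →ₗ[K] L) (M kerα : Submodule K L) : Prop :=
  IsSubalgebra br kerα ∧ Module.finrank K kerα + 1 = Module.finrank K M ∧
    (TypeA br M kerα ∨ TypeB br M kerα ∨ TypeC br M kerα ∨ TypeD br M kerα)

end OmegaLie

namespace OmegaLie

variable {K L : Type*} [Field K] [AddCommGroup L] [Module K L]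

/-! The heart of the matter is that in dimension n ≥ 4 the form ω has rank at most 2. Computing
[[x,y],[z,t]] in two ways and eliminating the triple products gives `four_identity`, which is linear
in the product and ties ω to its differential dω (`dForm`). Traces of left multiplications then give
tr[x,y] = (n-2)ω(x,y) and (n-2)dω = ω ∧ tr, and these two force ω ∧ ω = 0 when n - 2 ≠ 0 in K
(`omega_square_eq_zero`). If n - 2 = 0 in K, the restriction on the characteristic makes n ≥ 7,
which leaves enough room to exclude rank ≥ 6 (`false_of_triple`) and rank 4 (`false_of_rank_four`)
directly.

If L is not Lie, Ker ω therefore has codimension 2, and `four_identity` makes it a subalgebra with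
product l(z)t - l(t)z (`bracket_ker`): it is abelian or almost abelian. It acts on L as a Lie
algebra, and for z in its abelian part the form (x,y) ↦ ω([z,x],y) is symmetric. Playing the action
against this symmetry produces a vector y outside Ker ω: in the abelian case y normalizes Ker ω, and
Ker ω + Ky has type (a); in the other case either the abelian part sends L into Ker ω, which is
(iii), or some y centralizes it, which is type (d). Types (b) and (c) are never needed. -/

/-- The cyclic sum `ω([x, y], z) + ω([z, x], y) + ω([y, z], x)`. -/
def dForm (br : L →ₗ[K] L →ₗ[K] L) (ω : L →ₗ[K] L →ₗ[K] K) (x y z : L) : K :=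
  ω (br x y) z + ω (br z x) y + ω (br y z) x

/-! ### Polynomial identities relating the product, ω and dω. -/

section Identities

variable {br : L →ₗ[K] L →ₗ[K] L} {ω : L →ₗ[K] L →ₗ[K] K}

lemma omega_swap (hω : ∀ x, ω x x = 0) (x y : L) : ω x y = -ω y x := by
  have h := hω (x + y)
  simp only [map_add, LinearMap.add_apply, hω, zero_add, add_zero] at h
  linear_combination h

namespace IsOmegaLieAlgebra

lemma swap (hL : IsOmegaLieAlgebra br ω) (x y : L) : br x y = -br y x := by
  have h := hL.bracket_self (x + y)
  simp only [map_add, LinearMap.add_apply, hL.bracket_self, zero_add, add_zero] at h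
  exact eq_neg_of_add_eq_zero_right h

lemma jacobi_sorted (hL : IsOmegaLieAlgebra br ω) (hω : ∀ x, ω x x = 0) (x y z : L) :
    br (br x y) z - br (br x z) y + br (br y z) x = ω x y • z - ω x z • y + ω y z • x := by
  have h := hL.omega_jacobi x y z
  rw [hL.swap z x, omega_swap hω z x] at h
  simp only [map_neg, LinearMap.neg_apply, neg_smul] at h
  rw [sub_eq_add_neg, sub_eq_add_neg]
  exact h

/-- This is the ω-Jacobi identity with [z,t] treated as a single third argument. -/
lemma bracket_bracket (hL : IsOmegaLieAlgebra br ω) (hω : ∀ x, ω x x = 0) (x y z t : L) :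
    br (br x y) (br z t) = -br (br (br z t) x) y + br (br (br z t) y) x + ω x y • br z t
      + ω (br z t) x • y - ω (br z t) y • x := by
  have h := hL.jacobi_sorted hω x y (br z t)
  rw [hL.swap x (br z t), hL.swap y (br z t), omega_swap hω x (br z t),
    omega_swap hω y (br z t)] at h
  simp only [map_neg, LinearMap.neg_apply] at h
  linear_combination (norm := module) h

/-- Anticommutativity of [x,y] and [z,t], each order being expanded by `bracket_bracket`. -/
lemma bracket_pairs (hL : IsOmegaLieAlgebra br ω) (hω : ∀ x, ω x x = 0) (x y z t : L) :
    -br (br (br z t) x) y + br (br (br z t) y) x - br (br (br x y) z) t + br (br (br x y) t) z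
      + ω x y • br z t + ω z t • br x y + ω (br z t) x • y - ω (br z t) y • x
      + ω (br x y) z • t - ω (br x y) t • z = 0 := by
  have h := hL.swap (br x y) (br z t)
  rw [hL.bracket_bracket hω x y z t, hL.bracket_bracket hω z t x y] at h
  linear_combination (norm := module) h

lemma bracket_jacobi (hL : IsOmegaLieAlgebra br ω) (hω : ∀ x, ω x x = 0) (x y z t : L) :
    br (br (br x y) z) t - br (br (br x z) y) t + br (br (br y z) x) t
      = ω x y • br z t - ω x z • br y t + ω y z • br x t := by
  have h := congrArg (fun w => br w t) (hL.jacobi_sorted hω x y z)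
  simpa only [map_add, map_sub, map_smul, LinearMap.add_apply, LinearMap.sub_apply,
    LinearMap.smul_apply] using h

/-- The fundamental identity of degree four. -/
lemma four_identity (hL : IsOmegaLieAlgebra br ω) (hω : ∀ x, ω x x = 0) (x y z t : L) :
    ω x y • br z t + ω z t • br x y - ω x z • br y t - ω y t • br x z
        + ω x t • br y z + ω y z • br x t
      = dForm br ω x y z • t - dForm br ω x y t • z + dForm br ω x z t • y
        - dForm br ω y z t • x := by
  have e1 := hL.bracket_pairs hω x y z t
  have e2 := hL.bracket_pairs hω x z y t
  have e3 := hL.bracket_pairs hω x t y z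
  have j1 := hL.bracket_jacobi hω x y z t
  have j2 := hL.bracket_jacobi hω x y t z
  have j3 := hL.bracket_jacobi hω x z t y
  have j4 := hL.bracket_jacobi hω y z t x
  rw [hL.swap t z] at j2
  rw [hL.swap t y, hL.swap z y] at j3
  rw [hL.swap t x, hL.swap z x, hL.swap y x] at j4
  simp only [dForm, hL.swap z x, hL.swap t x, hL.swap t y, map_neg, LinearMap.neg_apply]
  -- Each of the twelve triple products occurs once among the `e` and once among the `j`, and all of
  -- them cancel.
  linear_combination (norm := module) (-1 : K) • e1 + (1 : K) • e2 - (1 : K) • e3 - (1 : K) • j1 + (1 : K) • j2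
    - (1 : K) • j3 + (1 : K) • j4

/-- Put a product [x,y] into `hd` and take the signed sum over the six choices of a pair. By Jacobi
the triple products add up to 4c²P, where P is the claimed expression; the last terms on the right
give 2c²P, and the rest is ω ∧ θ ∧ θ = 0. So 2c²P = 0. It is used with θ a trace and c = n - 2, and
again with c = 1 in rank 4. -/
lemma omega_square_eq_zero (hL : IsOmegaLieAlgebra br ω) (hω : ∀ x, ω x x = 0)
    (h2 : (2 : K) ≠ 0) (θ : L →ₗ[K] K) {c : K} (hc : c ≠ 0)
    (hθ : ∀ x y, θ (br x y) = c * ω x y)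
    (hd : ∀ x y z, c * dForm br ω x y z = ω x y * θ z - ω x z * θ y + ω y z * θ x)
    (x y z t : L) : ω x y * ω z t - ω x z * ω y t + ω x t * ω y z = 0 := by
  have J : ∀ x y z t : L, ω (br (br x y) z) t - ω (br (br x z) y) t + ω (br (br y z) x) t
      = ω x y * ω z t - ω x z * ω y t + ω y z * ω x t := fun x y z t => by
    have h := congrArg (fun w => ω w t) (hL.jacobi_sorted hω x y z)
    simpa only [map_add, map_sub, map_smul, LinearMap.add_apply, LinearMap.sub_apply,
      LinearMap.smul_apply, smul_eq_mul] using h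
  have D : ∀ x y z t : L, c * (ω (br (br x y) z) t - ω (br (br x y) t) z + ω (br z t) (br x y))
      = ω (br x y) z * θ t - ω (br x y) t * θ z + ω z t * (c * ω x y) := fun x y z t => by
    have h := hd (br x y) z t
    rw [hθ, dForm, hL.swap t (br x y)] at h
    simp only [map_neg, LinearMap.neg_apply] at h
    linear_combination h
  have E : ∀ x y z : L, c * (ω (br x y) z - ω (br x z) y + ω (br y z) x)
      = ω x y * θ z - ω x z * θ y + ω y z * θ x := fun x y z => by
    have h := hd x y z
    rw [dForm, hL.swap z x] at h
    simp only [map_neg, LinearMap.neg_apply] at h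
    linear_combination h
  have S := omega_swap hω
  have key : 2 * c ^ 2 * (ω x y * ω z t - ω x z * ω y t + ω x t * ω y z) = 0 := by
    have j1 := J x y z t
    have j2 := J x y t z
    have j3 := J x z t y
    have j4 := J y z t x
    rw [S t z] at j2
    rw [S t y, S z y] at j3
    rw [S t x, S z x, S y x] at j4
    have s1 := S (br x y) (br z t)
    have s2 := S (br x z) (br y t)
    have s3 := S (br x t) (br y z)
    linear_combination c * (D x y z t + D z t x y - D x z y t - D y t x z + D x t y z + D y z x t)
      - c ^ 2 * (j1 - j2 + j3 - j4) - c ^ 2 * (s1 - s2 + s3)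
      + θ t * E x y z - θ z * E x y t + θ y * E x z t - θ x * E y z t
  have : 2 * c ^ 2 ≠ 0 := mul_ne_zero h2 (pow_ne_zero 2 hc)
  exact (mul_eq_zero.mp key).resolve_left this

end IsOmegaLieAlgebra

end Identities

/-! ### Traces of left multiplications. -/

section Trace

variable {br : L →ₗ[K] L →ₗ[K] L} {ω : L →ₗ[K] L →ₗ[K] K}

namespace IsOmegaLieAlgebra

/-- As an identity of operators in z, ω-Jacobi says that left multiplication by [x,y] is a
commutator plus ω(x,y)·1 plus two operators of rank at most one. -/
lemma trace_bracket [FiniteDimensional K L] (hL : IsOmegaLieAlgebra br ω)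
    (hω : ∀ x, ω x x = 0) (x y : L) :
    LinearMap.trace K L (br (br x y)) = ((Module.finrank K L : K) - 2) * ω x y := by
  have h : br (br x y) + (br y * br x - br x * br y)
      = ω x y • (1 : Module.End K L) - (ω x).smulRight y + (ω y).smulRight x := by
    ext z
    have := hL.jacobi_sorted hω x y z
    simp only [LinearMap.add_apply, LinearMap.sub_apply, Module.End.mul_apply,
      LinearMap.smul_apply, Module.End.one_apply, LinearMap.smulRight_apply]
    rw [← this, hL.swap (br x z), hL.swap (br y z)]
    abel
  have t := congrArg (LinearMap.trace K L) h
  simp only [map_add, map_sub, map_smul, LinearMap.trace_smulRight, LinearMap.trace_one,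
    LinearMap.trace_mul_comm K (br y) (br x), sub_self, add_zero, smul_eq_mul] at t
  rw [t, omega_swap hω y x]
  ring

/-- The trace of `four_identity`, read as an identity of operators in t. -/
lemma finrank_sub_two_mul_dForm [FiniteDimensional K L] (hL : IsOmegaLieAlgebra br ω)
    (hω : ∀ x, ω x x = 0) (x y z : L) :
    ((Module.finrank K L : K) - 2) * dForm br ω x y z
      = ω x y * LinearMap.trace K L (br z) - ω x z * LinearMap.trace K L (br y)
        + ω y z * LinearMap.trace K L (br x) := by
  have d : ∀ x y : L, ∃ f : L →ₗ[K] K, ∀ t, dForm br ω x y t = f t := fun x y =>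
    ⟨ω (br x y) + ω.flip y ∘ₗ br.flip x + ω.flip x ∘ₗ br y, fun t => rfl⟩
  obtain ⟨f, hf⟩ := d x y
  obtain ⟨g, hg⟩ := d x z
  obtain ⟨k, hk⟩ := d y z
  have h : ω x y • br z + (ω z).smulRight (br x y) - ω x z • br y - (ω y).smulRight (br x z)
        + (ω x).smulRight (br y z) + ω y z • br x
      = dForm br ω x y z • (1 : Module.End K L) - f.smulRight z + g.smulRight y
        - k.smulRight x := by
    ext t
    have := hL.four_identity hω x y z t
    simpa only [LinearMap.add_apply, LinearMap.sub_apply, LinearMap.smul_apply,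
      Module.End.one_apply, LinearMap.smulRight_apply, ← hf, ← hg, ← hk] using this
  have t := congrArg (LinearMap.trace K L) h
  simp only [map_add, map_sub, map_smul, LinearMap.trace_smulRight, LinearMap.trace_one,
    smul_eq_mul, ← hf, ← hg, ← hk] at t
  simp only [dForm, hL.swap z x, hL.swap z y, hL.swap y x, map_neg, LinearMap.neg_apply,
    omega_swap hω z, omega_swap hω y (br x z), omega_swap hω x (br y z)] at t ⊢
  linear_combination -t

/-- If `dim L - 2` is invertible then `ω` has rank at most `2`. -/
lemma omega_square_eq_zero_of_finrank [FiniteDimensional K L] (hL : IsOmegaLieAlgebra br ω)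
    (hω : ∀ x, ω x x = 0) (h2 : (2 : K) ≠ 0) (hn : (Module.finrank K L : K) - 2 ≠ 0)
    (x y z t : L) : ω x y * ω z t - ω x z * ω y t + ω x t * ω y z = 0 :=
  hL.omega_square_eq_zero hω h2 (LinearMap.trace K L ∘ₗ br) hn (hL.trace_bracket hω)
    (hL.finrank_sub_two_mul_dForm hω) x y z t

end IsOmegaLieAlgebra

end Trace

/-! ### Excluding rank above 2, and the product on the kernel of ω. -/

section Rank

variable {br : L →ₗ[K] L →ₗ[K] L} {ω : L →ₗ[K] L →ₗ[K] K}

lemma exists_ne_zero_of_functionals [FiniteDimensional K L] {k : ℕ} (f : Fin k → (L →ₗ[K] K))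
    (hk : k < Module.finrank K L) : ∃ q : L, q ≠ 0 ∧ ∀ i, f i q = 0 := by
  have h : LinearMap.ker (LinearMap.pi f) ≠ ⊥ :=
    LinearMap.ker_ne_bot_of_finrank_lt (by simpa using hk)
  obtain ⟨q, hq, hq0⟩ := Submodule.exists_mem_ne_zero_of_ne_bot h
  exact ⟨q, hq0, fun i => congrFun (LinearMap.mem_ker.mp hq) i⟩

lemma dForm_cyclic (x y z : L) : dForm br ω x y z = dForm br ω y z x := by
  simp only [dForm]; ring

/-- Two mutually orthogonal hyperbolic pairs. -/
structure OrthPairs (ω : L →ₗ[K] L →ₗ[K] K) (u v u' v' : L) : Prop where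
  left : ω u v = 1
  right : ω u' v' = 1
  uu : ω u u' = 0
  uv : ω u v' = 0
  vu : ω v u' = 0
  vv : ω v v' = 0

lemma OrthPairs.symm (hω : ∀ x, ω x x = 0) {u v u' v' : L} (h : OrthPairs ω u v u' v') :
    OrthPairs ω u' v' u v where
  left := h.right
  right := h.left
  uu := by rw [omega_swap hω, h.uu, neg_zero]
  uv := by rw [omega_swap hω, h.vu, neg_zero]
  vu := by rw [omega_swap hω, h.uv, neg_zero]
  vv := by rw [omega_swap hω, h.vv, neg_zero]

lemma OrthPairs.of_ne_zero {u v x y : L} (huv : ω u v = 1)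
    (hx : ω u x = 0 ∧ ω v x = 0) (hy : ω u y = 0 ∧ ω v y = 0) (hxy : ω x y ≠ 0) :
    OrthPairs ω u v ((ω x y)⁻¹ • x) y where
  left := huv
  right := by simp [hxy]
  uu := by simp [hx.1]
  uv := hy.1
  vu := by simp [hx.2]
  vv := hy.2

/-- The vector `p` is orthogonal to all of `u, v, u', v'`. -/
structure OrthTo (ω : L →ₗ[K] L →ₗ[K] K) (u v u' v' p : L) : Prop where
  u : ω u p = 0
  v : ω v p = 0
  u' : ω u' p = 0
  v' : ω v' p = 0

lemma OrthTo.symm {u v u' v' p : L} (h : OrthTo ω u v u' v' p) : OrthTo ω u' v' u v p :=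
  ⟨h.u', h.v', h.u, h.v⟩

namespace IsOmegaLieAlgebra

/-- A hyperbolic pair determines, through dω, all products of vectors orthogonal to it up to a
multiple of [u,v]. Comparing the outcomes for different pairs drives this part. -/
lemma bracket_perp (hL : IsOmegaLieAlgebra br ω) (hω : ∀ x, ω x x = 0) {u v p q : L}
    (huv : ω u v = 1) (hup : ω u p = 0) (hvp : ω v p = 0) (huq : ω u q = 0) (hvq : ω v q = 0) :
    br p q + ω p q • br u v = dForm br ω u v p • q - dForm br ω u v q • p
      + dForm br ω u p q • v - dForm br ω v p q • u := by
  have h := hL.four_identity hω u v p q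
  simpa only [huv, hup, hvp, huq, hvq, one_smul, zero_smul, sub_zero, add_zero] using h

lemma dForm_eq_two_mul_sub (hL : IsOmegaLieAlgebra br ω) (hω : ∀ x, ω x x = 0)
    {u v u' v' p : L} (h : OrthPairs ω u v u' v') (hp : OrthTo ω u v u' v' p) :
    ω (br u' v') p = -ω (br u v) p ∧
      dForm br ω u' v' p = 2 * dForm br ω u v p - ω (br u v) p := by
  have e1 := congrArg (fun w => ω w p) (hL.bracket_perp hω h.left h.uu h.vu h.uv h.vv)
  have e2 := congrArg (fun w => ω w v') (hL.bracket_perp hω h.left hp.u hp.v h.uu h.vu)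
  have e3 := congrArg (fun w => ω w u') (hL.bracket_perp hω h.left h.uv h.vv hp.u hp.v)
  have s1 : ω p v' = 0 := by rw [omega_swap hω, hp.v', neg_zero]
  have s2 : ω p u' = 0 := by rw [omega_swap hω, hp.u', neg_zero]
  have s3 : ω v' u' = -1 := by rw [omega_swap hω, h.right]
  simp only [map_add, map_sub, map_smul, LinearMap.add_apply, LinearMap.sub_apply,
    LinearMap.smul_apply, smul_eq_mul, hp.u, hp.v, hp.u', hp.v', h.right, h.uu, h.uv, h.vu, h.vv,
    s1, s2, s3, mul_zero, zero_mul, mul_one, sub_zero, add_zero, one_mul] at e1 e2 e3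
  refine ⟨by linear_combination e1, ?_⟩
  rw [dForm]
  linear_combination e1 + e2 + e3

/-- Apply `dForm_eq_two_mul_sub` in both directions and add: the terms ω([u,v],p) and ω([u',v'],p)
cancel. -/
lemma dForm_opposite (hL : IsOmegaLieAlgebra br ω) (hω : ∀ x, ω x x = 0)
    {u v u' v' p : L} (h : OrthPairs ω u v u' v') (hp : OrthTo ω u v u' v' p) :
    dForm br ω u' v' p = -dForm br ω u v p := by
  obtain ⟨h1, h2⟩ := hL.dForm_eq_two_mul_sub hω h hp
  obtain ⟨-, h3⟩ := hL.dForm_eq_two_mul_sub hω (h.symm hω) hp.symm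
  linear_combination -h2 - h3 + h1

/-- Either pair computes [p,q]. By `dForm_opposite` the parts along p and q are opposite, and
pairing with u, v, u', v' kills the rest, so twice the combination of p and q vanishes. -/
lemma dForm_eq_zero_of_perp (hL : IsOmegaLieAlgebra br ω) (hω : ∀ x, ω x x = 0)
    (h2 : (2 : K) ≠ 0) {u v u' v' p q : L} (h : OrthPairs ω u v u' v')
    (hp : OrthTo ω u v u' v' p) (hq : OrthTo ω u v u' v' q) (hpq : ω p q = 0)
    (hspan : ∀ c : K, q ≠ c • p) : dForm br ω u v p = 0 := by
  have e := hL.bracket_perp hω h.left hp.u hp.v hq.u hq.v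
  have e' := hL.bracket_perp hω h.right hp.u' hp.v' hq.u' hq.v'
  rw [hL.dForm_opposite hω h hp, hL.dForm_opposite hω h hq] at e'
  rw [hpq, zero_smul, add_zero] at e e'
  have h' := h.symm hω
  have zero : ∀ w, ω w p = 0 → ω p w = 0 := fun w hw => by rw [omega_swap hω, hw, neg_zero]
  have zero' : ∀ w, ω w q = 0 → ω q w = 0 := fun w hw => by rw [omega_swap hω, hw, neg_zero]
  have ee := e.symm.trans e'
  have eu := congrArg (fun w => ω w u) ee
  have ev := congrArg (fun w => ω w v) ee
  have eu' := congrArg (fun w => ω w u') ee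
  have ev' := congrArg (fun w => ω w v') ee
  have s1 : ω v u = -1 := by rw [omega_swap hω, h.left]
  have s2 : ω v' u' = -1 := by rw [omega_swap hω, h.right]
  simp only [map_add, map_sub, map_smul, LinearMap.add_apply, LinearMap.sub_apply,
    LinearMap.smul_apply, smul_eq_mul, zero _ hp.u, zero _ hp.v, zero _ hp.u', zero _ hp.v',
    zero' _ hq.u, zero' _ hq.v, zero' _ hq.u', zero' _ hq.v', h.left, h.right, h.uu, h.uv, h.vu,
    h.vv, h'.uu, h'.uv, h'.vu, h'.vv, hω, s1, s2, mul_zero, sub_zero, add_zero, mul_one, zero_sub,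
    zero_add, mul_neg, neg_eq_zero, sub_self, zero_eq_neg] at eu ev eu' ev'
  rw [eu, ev, eu', ev'] at ee
  simp only [zero_smul, add_zero, sub_zero] at ee
  have e3 : dForm br ω u v p • q = dForm br ω u v q • p := by
    have : (2 : K) • (dForm br ω u v p • q - dForm br ω u v q • p) = 0 := by
      linear_combination (norm := module) ee
    exact sub_eq_zero.mp ((smul_eq_zero.mp this).resolve_left h2)
  by_contra hne
  refine hspan ((dForm br ω u v p)⁻¹ * dForm br ω u v q) ?_
  rw [mul_smul, ← e3, smul_smul, inv_mul_cancel₀ hne, one_smul]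

/-- Dimension above 6 supplies q ≠ 0 killed by six functionals; since ω(f,q) = 0 ≠ ω(f,p), it is not
a multiple of p. -/
lemma dForm_eq_zero_of_triple [FiniteDimensional K L] (hL : IsOmegaLieAlgebra br ω)
    (hω : ∀ x, ω x x = 0) (h2 : (2 : K) ≠ 0) (hn : 6 < Module.finrank K L) {u v u' v' p f : L}
    (h : OrthPairs ω u v u' v') (hp : OrthTo ω u v u' v' p) (hpf : ω f p ≠ 0) :
    dForm br ω u v p = 0 := by
  obtain ⟨q, hq0, hq⟩ := exists_ne_zero_of_functionals ![ω u, ω v, ω u', ω v', ω p, ω f] hn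
  refine hL.dForm_eq_zero_of_perp hω h2 h hp ⟨hq 0, hq 1, hq 2, hq 3⟩ (hq 4) ?_
  rintro c rfl
  have h5 : ω f (c • p) = 0 := hq 5
  rw [map_smul, smul_eq_mul] at h5
  exact hq0 (by rw [(mul_eq_zero.mp h5).resolve_right hpf, zero_smul])

lemma bracket_eq_neg_of_triple [FiniteDimensional K L] (hL : IsOmegaLieAlgebra br ω)
    (hω : ∀ x, ω x x = 0) (h2 : (2 : K) ≠ 0) (hn : 6 < Module.finrank K L) {u v u' v' e f : L}
    (h : OrthPairs ω u v u' v') (h1 : OrthPairs ω u v e f) (h3 : OrthPairs ω u' v' e f) :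
    br u' v' = -br u v := by
  have b := hL.bracket_perp hω h.left h.uu h.vu h.uv h.vv
  have h1' := h1.symm hω
  have h3' := h3.symm hω
  have h' := h.symm hω
  have ne1 : ω u v ≠ 0 := by rw [h.left]; exact one_ne_zero
  have ne2 : ω v u ≠ 0 := by rw [omega_swap hω, h.left]; exact neg_ne_zero.mpr one_ne_zero
  have ne1' : ω u' v' ≠ 0 := by rw [h.right]; exact one_ne_zero
  have ne2' : ω v' u' ≠ 0 := by rw [omega_swap hω, h.right]; exact neg_ne_zero.mpr one_ne_zero
  have a1 := hL.dForm_eq_zero_of_triple hω h2 hn h1 ⟨h.uu, h.vu, h3'.uu, h3'.vu⟩ ne2'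
  have a2 := hL.dForm_eq_zero_of_triple hω h2 hn h1 ⟨h.uv, h.vv, h3'.uv, h3'.vv⟩ ne1'
  have a3 := hL.dForm_eq_zero_of_triple hω h2 hn h3 ⟨h'.uu, h'.vu, h1'.uu, h1'.vu⟩ ne2
  have a4 := hL.dForm_eq_zero_of_triple hω h2 hn h3 ⟨h'.uv, h'.vv, h1'.uv, h1'.vv⟩ ne1
  rw [dForm_cyclic u u' v', dForm_cyclic v u' v', a1, a2, a3, a4, h.right] at b
  simp only [one_smul, zero_smul, sub_zero, add_zero] at b
  exact eq_neg_of_add_eq_zero_left b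

/-- The products of the three pairs are pairwise opposite, hence zero. -/
lemma bracket_eq_zero_of_triple [FiniteDimensional K L] (hL : IsOmegaLieAlgebra br ω)
    (hω : ∀ x, ω x x = 0) (h2 : (2 : K) ≠ 0) (hn : 6 < Module.finrank K L) {u v u' v' e f : L}
    (h : OrthPairs ω u v u' v') (h1 : OrthPairs ω u v e f) (h3 : OrthPairs ω u' v' e f) :
    br u v = 0 := by
  have a := hL.bracket_eq_neg_of_triple hω h2 hn h h1 h3
  have b := hL.bracket_eq_neg_of_triple hω h2 hn h1 h (h3.symm hω)
  have c := hL.bracket_eq_neg_of_triple hω h2 hn h3 (h.symm hω) (h1.symm hω)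
  rw [b, a] at c
  have : (2 : K) • br u v = 0 := by linear_combination (norm := module) -c
  exact (smul_eq_zero.mp this).resolve_left h2

/-- In large dimension the form does not have three orthogonal hyperbolic pairs. -/
lemma false_of_triple [FiniteDimensional K L] (hL : IsOmegaLieAlgebra br ω)
    (hω : ∀ x, ω x x = 0) (h2 : (2 : K) ≠ 0) (hn : 6 < Module.finrank K L) {u v u' v' e f : L}
    (h : OrthPairs ω u v u' v') (h1 : OrthPairs ω u v e f) (h3 : OrthPairs ω u' v' e f) :
    False := by
  have h' := h.symm hω
  have s1 : ω v u = -1 := by rw [omega_swap hω, h.left]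
  have s2 : ω v' u' = -1 := by rw [omega_swap hω, h.right]
  have b0 := hL.bracket_eq_zero_of_triple hω h2 hn h h1 h3
  -- Symplectic changes of the first two pairs again give three orthogonal pairs, so [u',v] = 0 and,
  -- below, [u,u'] = 0; Jacobi for u, v, u' then says u' = 0.
  have b1 : br (u + u') v = 0 := by
    refine hL.bracket_eq_zero_of_triple hω h2 hn (u' := u') (v' := v' - v) (e := e) (f := f)
      ⟨?_, ?_, ?_, ?_, ?_, ?_⟩ ⟨?_, ?_, ?_, ?_, ?_, ?_⟩ ⟨?_, ?_, ?_, ?_, ?_, ?_⟩ <;>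
    simp [h.left, h.right, h.uu, h.uv, h.vu, h.vv, h'.uv, h1.right, h1.uu,
      h1.uv, h1.vu, h1.vv, h3.uu, h3.uv, h3.vu, h3.vv, hω]
  have b2 : br u (v + u') = 0 := by
    refine hL.bracket_eq_zero_of_triple hω h2 hn (u' := u') (v' := v' + u) (e := e) (f := f)
      ⟨?_, ?_, ?_, ?_, ?_, ?_⟩ ⟨?_, ?_, ?_, ?_, ?_, ?_⟩ ⟨?_, ?_, ?_, ?_, ?_, ?_⟩ <;>
    simp [h.left, h.right, h.uu, h.uv, h.vu, h.vv, h'.uu, h1.right, h1.uu,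
      h1.uv, h1.vu, h1.vv, h3.uu, h3.uv, h3.vu, h3.vv, hω, s1]
  rw [map_add, LinearMap.add_apply, b0, zero_add] at b1
  rw [map_add, b0, zero_add] at b2
  have j := hL.jacobi_sorted hω u v u'
  rw [b0, b2, hL.swap v u', b1, h.left, h.uu, h.vu] at j
  simp only [map_zero, LinearMap.zero_apply, neg_zero, sub_zero, add_zero, one_smul,
    zero_smul] at j
  have := h.right
  rw [← j] at this
  simp at this

/-- The kernel of `ω` is a subalgebra. -/
lemma omega_bracket_ker (hL : IsOmegaLieAlgebra br ω) (hω : ∀ x, ω x x = 0) (h2 : (2 : K) ≠ 0)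
    {z t : L} (hz : ω z = 0) (ht : ω t = 0) : ω (br z t) = 0 := by
  ext w
  rw [LinearMap.zero_apply]
  by_cases hw : ω w = 0
  · rw [omega_swap hω, hw, LinearMap.zero_apply, neg_zero]
  obtain ⟨w', hw'⟩ : ∃ w', ω w w' ≠ 0 := by
    by_contra! hcon
    exact hw (LinearMap.ext hcon)
  have hzr : ∀ w, ω w z = 0 := fun w => by rw [omega_swap hω, hz, LinearMap.zero_apply, neg_zero]
  have htr : ∀ w, ω w t = 0 := fun w => by rw [omega_swap hω, ht, LinearMap.zero_apply, neg_zero]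
  have dw : dForm br ω w z t = ω (br z t) w := by rw [dForm, htr, hzr, zero_add, zero_add]
  have e := congrArg (fun p => ω p w) (hL.four_identity hω w w' z t)
  simp only [map_add, map_sub, map_smul, LinearMap.add_apply, LinearMap.sub_apply,
    LinearMap.smul_apply, smul_eq_mul, hz, ht, hzr, htr, hω, dw, LinearMap.zero_apply, mul_zero,
    zero_mul, sub_zero, add_zero, zero_add, omega_swap hω w' w] at e
  have : 2 * ω w w' * ω (br z t) w = 0 := by linear_combination e
  exact (mul_eq_zero.mp this).resolve_left (mul_ne_zero h2 hw')

/-- With z and t in the kernel, almost all terms of `four_identity` vanish. Dividing by some ω(x,y)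
≠ 0, the product on Ker ω is governed by a single linear form. -/
lemma bracket_ker (hL : IsOmegaLieAlgebra br ω) (hω : ∀ x, ω x x = 0) (h2 : (2 : K) ≠ 0)
    {z t : L} (hz : ω z = 0) (ht : ω t = 0) (x y : L) :
    ω x y • br z t = dForm br ω x y z • t - dForm br ω x y t • z := by
  have hzr : ∀ w, ω w z = 0 := fun w => by rw [omega_swap hω, hz, LinearMap.zero_apply, neg_zero]
  have htr : ∀ w, ω w t = 0 := fun w => by rw [omega_swap hω, ht, LinearMap.zero_apply, neg_zero]
  have dw : ∀ w, dForm br ω w z t = 0 := fun w => by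
    rw [dForm, htr, hzr, hL.omega_bracket_ker hω h2 hz ht, LinearMap.zero_apply, zero_add,
      zero_add]
  have e := hL.four_identity hω x y z t
  simpa only [dw, hz, hzr, htr, LinearMap.zero_apply, zero_smul, add_zero, sub_zero] using e

/-- In large dimension the form does not have rank `4`. -/
lemma false_of_rank_four [FiniteDimensional K L] (hL : IsOmegaLieAlgebra br ω)
    (hω : ∀ x, ω x x = 0) (h2 : (2 : K) ≠ 0) (hn : 6 < Module.finrank K L) {u v u' v' : L}
    (h : OrthPairs ω u v u' v')
    (hker : ∀ p, OrthTo ω u v u' v' p → ∀ w, ω p w = 0) : False := by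
  obtain ⟨z, hz0, hz⟩ := exists_ne_zero_of_functionals ![ω u, ω v, ω u', ω v']
    (by omega : 4 < Module.finrank K L)
  have hzO : OrthTo ω u v u' v' z := ⟨hz 0, hz 1, hz 2, hz 3⟩
  have hzl := hker z hzO
  have hzr : ∀ w, ω w z = 0 := fun w => by rw [omega_swap hω, hzl, neg_zero]
  obtain ⟨φ, hφ⟩ := Module.Projective.exists_dual_eq_one K hz0
  obtain ⟨t, ht0, ht⟩ := exists_ne_zero_of_functionals ![ω u, ω v, ω u', ω v', φ]
    (by omega : 5 < Module.finrank K L)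
  have htO : OrthTo ω u v u' v' t := ⟨ht 0, ht 1, ht 2, ht 3⟩
  have htφ : φ t = 0 := ht 4
  have htl := hker t htO
  have Fz : dForm br ω u v z = 0 := by
    refine hL.dForm_eq_zero_of_perp hω h2 h hzO htO (hzl t) ?_
    rintro c rfl
    rw [map_smul, hφ, smul_eq_mul, mul_one] at htφ
    exact ht0 (by rw [htφ, zero_smul])
  have Ft : dForm br ω u v t = 0 := by
    refine hL.dForm_eq_zero_of_perp hω h2 h htO hzO (htl z) ?_
    rintro c rfl
    rw [map_smul, htφ, smul_zero] at hφ
    exact zero_ne_one hφ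
  have hzt : br z t = 0 := by
    have b := hL.bracket_ker hω h2 (LinearMap.ext hzl) (LinearMap.ext htl) u v
    rwa [Fz, Ft, h.left, one_smul, zero_smul, zero_smul, sub_zero] at b
  have dz : ∀ x y, dForm br ω x y z = 0 := fun x y => by
    have e := hL.bracket_ker hω h2 (LinearMap.ext hzl) (LinearMap.ext htl) x y
    rw [hzt, smul_zero] at e
    have e' := congrArg φ e
    simp only [map_zero, map_sub, map_smul, htφ, hφ, smul_eq_mul, mul_zero, mul_one,
      zero_sub] at e'
    rw [zero_eq_neg.mp e', zero_smul, sub_zero] at e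
    exact (smul_eq_zero.mp e.symm).resolve_right ht0
  -- Since dω(·,·,z) = 0, `four_identity` involving z retains only multiples of z on the right; it
  -- will show that Kz is an ideal.
  have star : ∀ x y w, ω x y • br z w - ω x w • br z y + ω y w • br z x
      = -dForm br ω x y w • z := fun x y w => by
    have e := hL.four_identity hω x y z w
    rw [dForm_cyclic x z w, dForm_cyclic z w x, dForm_cyclic y z w, dForm_cyclic z w y,
      dz, dz, dz, hzl, hzr, hzr, hL.swap x z, hL.swap y z] at e
    linear_combination (norm := module) e
  have hu : br z u = -dForm br ω u' v' u • z := by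
    have e := star u' v' u
    have h' := h.symm hω
    rwa [h.right, h'.uu, h'.vu, zero_smul, zero_smul, sub_zero, add_zero, one_smul] at e
  have hv : br z v = -dForm br ω u' v' v • z := by
    have e := star u' v' v
    have h' := h.symm hω
    rwa [h.right, h'.uv, h'.vv, zero_smul, zero_smul, sub_zero, add_zero, one_smul] at e
  have hμ : ∀ w, br z w = φ (br z w) • z := fun w => by
    obtain ⟨c, hc⟩ : ∃ c : K, br z w = c • z := by
      have e := star u v w
      rw [h.left, hu, hv, one_smul] at e
      refine ⟨-dForm br ω u v w - ω u w * dForm br ω u' v' v + ω v w * dForm br ω u' v' u, ?_⟩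
      linear_combination (norm := module) e
    rw [hc, map_smul, hφ, smul_eq_mul, mul_one]
  -- Write [z,w] = μ(w)z. Jacobi with z gives ω(x,y) = -μ([x,y]), and `star` gives dω = -ω ∧ μ, so
  -- -μ can play the trace with c = 1.
  have key := hL.omega_square_eq_zero hω h2 (-(φ ∘ₗ br z)) one_ne_zero (fun x y => ?_)
    (fun x y w => ?_) u v u' v'
  · rw [h.left, h.right, h.uu, h.uv, zero_mul, zero_mul] at key
    simp at key
  · have j := congrArg φ (hL.jacobi_sorted hω x y z)
    rw [hL.swap (br x y) z, hL.swap x z, hL.swap y z, hμ x, hμ y, hzr, hzr] at j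
    simp only [map_neg, map_sub, map_add, map_smul, LinearMap.neg_apply, LinearMap.smul_apply,
      hφ, smul_eq_mul, zero_smul, mul_one, sub_zero, add_zero] at j
    simp only [LinearMap.neg_apply, LinearMap.comp_apply]
    linear_combination j
  · have e := congrArg φ (star x y w)
    simp only [map_sub, map_add, map_smul, hφ, smul_eq_mul] at e
    simp only [LinearMap.neg_apply, LinearMap.comp_apply]
    linear_combination e

/-- In dimension at least `4`, a hyperbolic pair has isotropic orthogonal complement. -/
lemma omega_eq_zero_of_perp [FiniteDimensional K L] (hL : IsOmegaLieAlgebra br ω)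
    (hω : ∀ x, ω x x = 0) (h2 : (2 : K) ≠ 0) (h3 : (3 : K) ≠ 0) (hn : 4 ≤ Module.finrank K L)
    {u v x y : L} (huv : ω u v = 1)
    (hx : ω u x = 0 ∧ ω v x = 0) (hy : ω u y = 0 ∧ ω v y = 0) : ω x y = 0 := by
  by_contra hxy
  by_cases hc : (Module.finrank K L : K) - 2 ≠ 0
  · have := hL.omega_square_eq_zero_of_finrank hω h2 hc u v x y
    rw [huv, hx.1, hy.1, one_mul, zero_mul, zero_mul, sub_zero, add_zero] at this
    exact hxy this
  rw [not_not] at hc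
  -- For n = 4, 5, 6 the number n - 2 is 2, 3 or 4, nonzero in K.
  have hn' : 6 < Module.finrank K L := by
    by_contra hle
    have h456 : Module.finrank K L = 4 ∨ Module.finrank K L = 5 ∨ Module.finrank K L = 6 := by
      omega
    rcases h456 with h | h | h <;> rw [h] at hc
    · exact h2 (by linear_combination hc)
    · exact h3 (by linear_combination hc)
    · exact mul_ne_zero h2 h2 (by linear_combination hc)
  have h := OrthPairs.of_ne_zero huv hx hy hxy
  generalize (ω x y)⁻¹ • x = u' at h
  have Z : ∀ {a b : L}, ω a b = 0 → ω b a = 0 := fun hab => by rw [omega_swap hω, hab, neg_zero]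
  by_cases hiso : ∃ p q, OrthTo ω u v u' y p ∧ OrthTo ω u v u' y q ∧ ω p q ≠ 0
  · obtain ⟨p, q, hp, hq, hpq⟩ := hiso
    exact hL.false_of_triple hω h2 hn' h (OrthPairs.of_ne_zero huv ⟨hp.u, hp.v⟩ ⟨hq.u, hq.v⟩ hpq)
      (OrthPairs.of_ne_zero h.right ⟨hp.u', hp.v'⟩ ⟨hq.u', hq.v'⟩ hpq)
  · push Not at hiso
    refine hL.false_of_rank_four hω h2 hn' h fun p hp w => ?_
    have h' := h.symm hω
    have s1 : ω v u = -1 := by rw [omega_swap hω, h.left]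
    have s2 : ω y u' = -1 := by rw [omega_swap hω, h.right]
    -- The second argument is the projection of w to the orthogonal complement of both pairs.
    have e := hiso p (w + ω v w • u - ω u w • v + ω y w • u' - ω u' w • y) hp
      ⟨by simp [h.left, h.uu, h.uv, hω], by simp [s1, h.vu, h.vv, hω],
        by simp [h.right, h'.uu, h'.uv, hω], by simp [s2, h'.vu, h'.vv, hω]⟩
    simpa [Z hp.u, Z hp.v, Z hp.u', Z hp.v'] using e

end IsOmegaLieAlgebra

end Rank

/-! ### Action of the kernel on L when ω has rank 2. -/

section RankTwo

variable {br : L →ₗ[K] L →ₗ[K] L} {ω : L →ₗ[K] L →ₗ[K] K}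

/-- The form `ω` has rank at most `2`: a vector orthogonal to both members of a pair on which
`ω` does not vanish lies in the kernel of `ω`. -/
def RankLETwo (ω : L →ₗ[K] L →ₗ[K] K) : Prop :=
  ∀ x y p : L, ω x y ≠ 0 → ω p x = 0 → ω p y = 0 → ω p = 0

lemma IsOmegaLieAlgebra.rankLETwo [FiniteDimensional K L] (hL : IsOmegaLieAlgebra br ω)
    (hω : ∀ x, ω x x = 0) (h2 : (2 : K) ≠ 0) (h3 : (3 : K) ≠ 0)
    (hn : 4 ≤ Module.finrank K L) : RankLETwo ω := by
  intro x y p hxy hpx hpy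
  ext w
  have huv : ω ((ω x y)⁻¹ • x) y = 1 := by simp [hxy]
  have hu : ω ((ω x y)⁻¹ • x) p = 0 := by
    rw [omega_swap hω, map_smul, hpx, smul_zero, neg_zero]
  have hv : ω y p = 0 := by rw [omega_swap hω, hpy, neg_zero]
  have hpu : ω p ((ω x y)⁻¹ • x) = 0 := by rw [map_smul, hpx, smul_zero]
  generalize (ω x y)⁻¹ • x = u at huv hu hpu
  have s : ω y u = -1 := by rw [omega_swap hω, huv]
  have e := hL.omega_eq_zero_of_perp hω h2 h3 hn (x := p) (y := w + ω y w • u - ω u w • y) huv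
    ⟨hu, hv⟩ ⟨by simp [hω, huv], by simp [hω, s]⟩
  simpa [hpu, hpy] using e

lemma RankLETwo.sub_mem_ker (hR : RankLETwo ω) (hω : ∀ x, ω x x = 0) {x y : L}
    (hxy : ω x y ≠ 0) (w : L) :
    ω (w - (ω w y / ω x y) • x - (ω w x / ω y x) • y) = 0 := by
  have hyx : ω y x ≠ 0 := by rw [omega_swap hω]; exact neg_ne_zero.mpr hxy
  refine hR x y _ hxy ?_ ?_ <;> simp [hω, hxy, hyx]

lemma RankLETwo.finrank_ker [FiniteDimensional K L] (hR : RankLETwo ω) (hω : ∀ x, ω x x = 0)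
    {u v : L} (huv : ω u v ≠ 0) :
    Module.finrank K (LinearMap.ker ω) + 2 = Module.finrank K L := by
  have hvu : ω v u ≠ 0 := by rw [omega_swap hω]; exact neg_ne_zero.mpr huv
  let f : L →ₗ[K] (Fin 2 → K) := LinearMap.pi ![ω.flip u, ω.flip v]
  have hf : ∀ w, f w = ![ω w u, ω w v] := fun w => by
    funext i; fin_cases i <;> rfl
  have hker : LinearMap.ker f = LinearMap.ker ω := by
    ext p
    rw [LinearMap.mem_ker, LinearMap.mem_ker, hf]
    constructor
    · intro h
      exact hR u v p huv (congrFun h 0) (congrFun h 1)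
    · intro h
      simp [h]
  have hsurj : LinearMap.range f = ⊤ := by
    rw [LinearMap.range_eq_top]
    intro a
    refine ⟨(a 1 / ω u v) • u + (a 0 / ω v u) • v, ?_⟩
    rw [hf]
    funext i
    fin_cases i <;> simp [hω, huv, hvu]
  have := LinearMap.finrank_range_add_finrank_ker f
  rw [hsurj, hker, finrank_top, Module.finrank_fin_fun] at this
  omega

lemma exists_mem_notMem_span [FiniteDimensional K L] {N : Submodule K L}
    (hN : 2 ≤ Module.finrank K N) (z : L) : ∃ t ∈ N, ∀ c : K, t ≠ c • z := by
  by_contra! hcon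
  have hle : N ≤ Submodule.span K {z} := fun t ht => by
    obtain ⟨c, hc⟩ := hcon t ht
    exact Submodule.mem_span_singleton.mpr ⟨c, hc.symm⟩
  have h1 := Submodule.finrank_mono hle
  have h2 := finrank_span_le_card (R := K) ({z} : Set L)
  simp at h2
  omega

namespace IsOmegaLieAlgebra

/-- On Ker ω the ω-terms of Jacobi disappear, so left multiplication is a representation on L. -/
lemma ker_jacobi (hL : IsOmegaLieAlgebra br ω) (hω : ∀ x, ω x x = 0) {z t : L}
    (hz : ω z = 0) (ht : ω t = 0) (w : L) :
    br (br z t) w = br z (br t w) - br t (br z w) := by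
  have j := hL.jacobi_sorted hω z t w
  rw [hz, ht, LinearMap.zero_apply, LinearMap.zero_apply, hL.swap (br z w), hL.swap (br t w)] at j
  linear_combination (norm := module) j

/-- For z in the kernel, dω(·,·,z) measures the failure of (x,y) ↦ ω([z,x],y) to be symmetric. -/
lemma dForm_ker (hL : IsOmegaLieAlgebra br ω) (hω : ∀ x, ω x x = 0) {z : L}
    (hz : ω z = 0) (x y : L) : dForm br ω x y z = ω (br z x) y - ω (br z y) x := by
  rw [dForm, omega_swap hω _ z, hz, hL.swap y z, LinearMap.zero_apply]
  simp only [map_neg, LinearMap.neg_apply]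
  ring

/-- If the kernel of `ω` is abelian, it is normalized by some vector outside of it. -/
lemma exists_normalizer_of_abelian_ker [FiniteDimensional K L] (hL : IsOmegaLieAlgebra br ω)
    (hω : ∀ x, ω x x = 0) (h2 : (2 : K) ≠ 0) (hR : RankLETwo ω)
    (hN : 2 ≤ Module.finrank K (LinearMap.ker ω)) {u v : L} (huv : ω u v ≠ 0)
    (hab : ∀ z t, ω z = 0 → ω t = 0 → br z t = 0) :
    ∃ y, ω y ≠ 0 ∧ ∀ z, ω z = 0 → ω (br z y) = 0 := by
  have sym : ∀ z, ω z = 0 → ∀ x y, ω (br z x) y = ω (br z y) x := by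
    intro z hz x y
    obtain ⟨t, ht, htz⟩ := exists_mem_notMem_span hN z
    have ht : ω t = 0 := ht
    have e := hL.bracket_ker hω h2 hz ht x y
    rw [hab z t hz ht, smul_zero, eq_comm, sub_eq_zero] at e
    have d0 : dForm br ω x y z = 0 := by
      by_contra hne
      refine htz ((dForm br ω x y z)⁻¹ * dForm br ω x y t) ?_
      rw [mul_smul, ← e, smul_smul, inv_mul_cancel₀ hne, one_smul]
    rw [hL.dForm_ker hω hz] at d0
    linear_combination d0
  by_cases hall : ∀ z, ω z = 0 → ∀ x, ω (br z x) x = 0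
  · refine ⟨u, fun h => huv (by rw [h, LinearMap.zero_apply]), fun z hz => LinearMap.ext fun x => ?_⟩
    have e := hall z hz (u + x)
    simp only [map_add, LinearMap.add_apply, hall z hz, sym z hz x u, zero_add, add_zero] at e
    exact (mul_eq_zero.mp (by linear_combination e : 2 * ω (br z u) x = 0)).resolve_left h2
  push Not at hall
  obtain ⟨r, hr, u₀, hs⟩ := hall
  obtain ⟨v₀, hv₀⟩ : ∃ v₀, v₀ = br r u₀ := ⟨_, rfl⟩
  rw [← hv₀] at hs
  have hs' : ω u₀ v₀ ≠ 0 := by rw [omega_swap hω]; exact neg_ne_zero.mpr hs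
  have hru : ω (br r v₀) u₀ = 0 := by rw [sym r hr, ← hv₀, hω]
  have comm : ∀ z t, ω z = 0 → ω t = 0 → ∀ w, br z (br t w) = br t (br z w) := by
    intro z t hz ht w
    have e := hL.ker_jacobi hω hz ht w
    rw [hab z t hz ht, map_zero, LinearMap.zero_apply] at e
    exact (sub_eq_zero.mp e.symm)
  -- Modulo r, each z sends u₀ into the kernel: b kills the u₀-pairing, and commuting with r makes
  -- the v₀-pairing equal to its own negative. Then z kills v₀ = [r,u₀], as the kernel is abelian.
  have red : ∀ z, ω z = 0 → ∃ b : K, ω (z - b • r) = 0 ∧ ω (br (z - b • r) u₀) = 0 ∧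
      br (z - b • r) v₀ = 0 := by
    intro z hz
    refine ⟨ω (br z u₀) u₀ / ω v₀ u₀, ?_, ?_⟩
    · rw [map_sub, map_smul, hz, hr, smul_zero, sub_zero]
    generalize hb : ω (br z u₀) u₀ / ω v₀ u₀ = b
    have hz' : ω (z - b • r) = 0 := by rw [map_sub, map_smul, hz, hr, smul_zero, sub_zero]
    have e1 : ω (br (z - b • r) u₀) u₀ = 0 := by
      simp only [map_sub, map_smul, LinearMap.sub_apply, LinearMap.smul_apply, ← hv₀, ← hb,
        smul_eq_mul]
      rw [div_mul_cancel₀ _ hs, sub_self]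
    generalize z - b • r = z' at hz' e1
    have e2 : ω (br z' u₀) v₀ = 0 := by
      have e3 : ω (br z' u₀) v₀ = ω v₀ (br z' u₀) := by
        rw [sym z' hz' u₀ v₀]
        nth_rewrite 1 [hv₀]
        rw [comm z' r hz' hr, sym r hr, ← hv₀]
      rw [omega_swap hω v₀] at e3
      exact (mul_eq_zero.mp (by linear_combination e3 : 2 * ω (br z' u₀) v₀ = 0)).resolve_left h2
    have e4 := hR u₀ v₀ _ hs' e1 e2
    refine ⟨e4, ?_⟩
    rw [hv₀, comm z' r hz' hr, hab _ _ hr e4]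
  by_cases hc : ω (br r v₀) v₀ = 0
  · refine ⟨v₀, fun h => hs (by rw [h, LinearMap.zero_apply]), fun z hz => ?_⟩
    obtain ⟨b, -, -, hb⟩ := red z hz
    rw [map_sub, map_smul, LinearMap.sub_apply, LinearMap.smul_apply, sub_eq_zero] at hb
    rw [hb, map_smul, hR u₀ v₀ _ hs' hru hc, smul_zero]
  -- Now [r,v₀] is a nonzero multiple of u₀ modulo the kernel. A nonzero z killing v₀ also kills u₀,
  -- hence all of L, and Jacobi for u₀, v₀, z yields ω(u₀,v₀)z = 0.
  · exfalso
    obtain ⟨t, ht, htr⟩ := exists_mem_notMem_span hN r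
    obtain ⟨b, hz', -, hzv⟩ := red t ht
    have hz0 : t - b • r ≠ 0 := fun h => htr b (sub_eq_zero.mp h)
    generalize t - b • r = z at hz' hzv hz0
    have hn := hR.sub_mem_ker hω hs' (br r v₀)
    rw [hru, zero_div, zero_smul, sub_zero] at hn
    have hzu : br z u₀ = 0 := by
      have e := hab z _ hz' hn
      rw [map_sub, map_smul, comm z r hz' hr, hzv, map_zero, zero_sub, neg_eq_zero] at e
      exact (smul_eq_zero.mp e).resolve_left (div_ne_zero hc hs')
    have hzw : ∀ w, br z w = 0 := by
      intro w
      have e := hab z _ hz' (hR.sub_mem_ker hω hs' w)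
      simpa only [map_sub, map_smul, hzu, hzv, smul_zero, sub_zero] using e
    have j := hL.jacobi_sorted hω u₀ v₀ z
    rw [hL.swap _ z, hL.swap u₀ z, hL.swap v₀ z, hzw, hzw, hzw, omega_swap hω u₀ z,
      omega_swap hω v₀ z, hz'] at j
    simp only [neg_zero, map_zero, LinearMap.zero_apply, sub_zero, zero_smul, add_zero] at j
    exact (smul_ne_zero hs' hz0) j.symm

/-- If the kernel of `ω` is almost abelian and its abelian part acts on `L` modulo the kernel in
a nontrivial way, then some vector outside of the kernel commutes with the abelian part. -/
lemma exists_centralizer_of_nonabelian_ker (hL : IsOmegaLieAlgebra br ω)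
    (hω : ∀ x, ω x x = 0) (h2 : (2 : K) ≠ 0) (hR : RankLETwo ω) (l : L →ₗ[K] K)
    (hl : ∀ z t, ω z = 0 → ω t = 0 → br z t = l z • t - l t • z)
    {x₀ a₀ w₀ : L} (hx : ω x₀ = 0) (hlx : l x₀ = 1) (ha₀ : ω a₀ = 0) (hla₀ : l a₀ = 0)
    (hact : ω (br a₀ w₀) ≠ 0) :
    ∃ y, ω y ≠ 0 ∧ (∀ a, ω a = 0 → l a = 0 → br a y = 0) ∧
      ω (br x₀ y - y) = 0 ∧ l (br x₀ y - y) = 0 := by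
  have hxa : ∀ a, ω a = 0 → l a = 0 → br x₀ a = a := fun a ha hla => by
    rw [hl x₀ a hx ha, hlx, hla, one_smul, zero_smul, sub_zero]
  have key : ∀ a, ω a = 0 → l a = 0 → ∀ x y,
      dForm br ω x y a = 0 ∧ ω x y • a = dForm br ω x y x₀ • a := by
    intro a ha hla x y
    have e := hL.bracket_ker hω h2 hx ha x y
    rw [hxa a ha hla] at e
    have e' := congrArg l e
    simp only [map_sub, map_smul, hla, hlx, smul_eq_mul, mul_zero, mul_one, zero_sub] at e'
    have d0 := zero_eq_neg.mp e'
    refine ⟨d0, ?_⟩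
    rwa [d0, zero_smul, sub_zero] at e
  have sym : ∀ a, ω a = 0 → l a = 0 → ∀ x y, ω (br a x) y = ω (br a y) x := by
    intro a ha hla x y
    have e := (key a ha hla x y).1
    rw [hL.dForm_ker hω ha] at e
    linear_combination e
  have ha₀0 : a₀ ≠ 0 := by
    rintro rfl
    simp at hact
  have hdx : ∀ x y, ω (br x₀ x) y - ω (br x₀ y) x = ω x y := by
    intro x y
    rw [← hL.dForm_ker hω hx]
    have e := (key a₀ ha₀ hla₀ x y).2
    rw [← sub_eq_zero, ← sub_smul] at e
    exact (sub_eq_zero.mp ((smul_eq_zero.mp e).resolve_right ha₀0)).symm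
  obtain ⟨u₀, hs⟩ : ∃ u₀, ω (br a₀ u₀) u₀ ≠ 0 := by
    by_contra! hall
    refine hact (LinearMap.ext fun x => ?_)
    have e := hall (w₀ + x)
    simp only [map_add, LinearMap.add_apply, hall, sym a₀ ha₀ hla₀ x w₀, zero_add,
      add_zero] at e
    exact (mul_eq_zero.mp (by linear_combination e : 2 * ω (br a₀ w₀) x = 0)).resolve_left h2
  obtain ⟨v₀, hv₀⟩ : ∃ v₀, v₀ = br a₀ u₀ := ⟨_, rfl⟩
  rw [← hv₀] at hs
  have hs' : ω u₀ v₀ ≠ 0 := by rw [omega_swap hω]; exact neg_ne_zero.mpr hs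
  -- The relation [x₀,a] = a, carried over to the action on L.
  have W : ∀ a, ω a = 0 → l a = 0 → ∀ w, br a w = br x₀ (br a w) - br a (br x₀ w) := by
    intro a ha hla w
    rw [← hL.ker_jacobi hω hx ha w, hxa a ha hla]
  have hau : ω (br a₀ v₀) u₀ = 0 := by rw [sym a₀ ha₀ hla₀, ← hv₀, hω]
  have W₀ := W a₀ ha₀ hla₀ u₀
  rw [← hv₀] at W₀
  have e1 : ω v₀ u₀ = ω (br x₀ v₀) u₀ + ω (br x₀ u₀) v₀ := by
    have e := congrArg (fun w => ω w u₀) W₀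
    simp only [map_sub, LinearMap.sub_apply] at e
    rw [sym a₀ ha₀ hla₀ _ u₀, ← hv₀, omega_swap hω v₀ (br x₀ u₀)] at e
    linear_combination e
  have e2 := hdx u₀ v₀
  rw [omega_swap hω u₀ v₀] at e2
  have xu : ω (br x₀ u₀) v₀ = 0 :=
    (mul_eq_zero.mp (by linear_combination e2 - e1 : 2 * ω (br x₀ u₀) v₀ = 0)).resolve_left h2
  have xv : ω (br x₀ v₀) u₀ = ω v₀ u₀ := by linear_combination -e1 - xu
  have hn := hR.sub_mem_ker hω hs' (br a₀ v₀)
  rw [hau, zero_div, zero_smul, sub_zero] at hn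
  -- Modulo the kernel [a₀,v₀] is c·u₀. Since x₀ preserves the kernel and [x₀,u₀] pairs to zero with
  -- v₀, pairing `W` at v₀ with v₀ gives 2c·ω(u₀,v₀) = 0.
  have hav : ω (br a₀ v₀) v₀ = 0 := by
    generalize hc : ω (br a₀ v₀) v₀ / ω u₀ v₀ = c at hn
    have hc' : ω (br a₀ v₀) v₀ = c * ω u₀ v₀ := by rw [← hc, div_mul_cancel₀ _ hs']
    have f1 : ω (br a₀ v₀) = c • ω u₀ := by
      rwa [map_sub, map_smul, sub_eq_zero] at hn
    have f2 := congrArg (fun f => f v₀) (hL.omega_bracket_ker hω h2 hx hn)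
    simp only [map_sub, map_smul, LinearMap.sub_apply, LinearMap.smul_apply, smul_eq_mul, xu,
      LinearMap.zero_apply, mul_zero, sub_zero] at f2
    have e := congrArg (fun w => ω w v₀) (W a₀ ha₀ hla₀ v₀)
    simp only [map_sub, LinearMap.sub_apply] at e
    rw [f2, sym a₀ ha₀ hla₀ (br x₀ v₀) v₀, f1, LinearMap.smul_apply, LinearMap.smul_apply,
      omega_swap hω u₀ (br x₀ v₀), xv, omega_swap hω v₀ u₀, smul_eq_mul, smul_eq_mul] at e
    have : 2 * (c * ω u₀ v₀) = 0 := by linear_combination e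
    rw [hc']
    exact (mul_eq_zero.mp this).resolve_left h2
  have hak : ω (br a₀ v₀) = 0 := hR u₀ v₀ _ hs' hau hav
  have hA : ∀ a, ω a = 0 → l a = 0 → ω (br a v₀) = 0 := by
    intro a ha hla
    have comm : br a v₀ = br a₀ (br a u₀) := by
      have e := hL.ker_jacobi hω ha ha₀ u₀
      rw [hl a a₀ ha ha₀, hla, hla₀, zero_smul, zero_smul, sub_zero, map_zero,
        LinearMap.zero_apply, ← hv₀] at e
      exact sub_eq_zero.mp e.symm
    refine hR u₀ v₀ _ hs' ?_ ?_
    · have e : ω (br a v₀) u₀ = ω v₀ (br a u₀) := by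
        rw [comm, sym a₀ ha₀ hla₀, ← hv₀]
      rw [omega_swap hω v₀, sym a ha hla u₀] at e
      exact (mul_eq_zero.mp (by linear_combination e : 2 * ω (br a v₀) u₀ = 0)).resolve_left h2
    · rw [comm, sym a₀ ha₀ hla₀, hak, LinearMap.zero_apply]
  have hnx : ω (br x₀ v₀ - v₀) = 0 := by
    refine hR u₀ v₀ _ hs' ?_ ?_
    · rw [map_sub, LinearMap.sub_apply, xv, sub_self]
    · have : br x₀ v₀ - v₀ = br a₀ (br x₀ u₀) := by
        linear_combination (norm := module) -W₀
      rw [this, sym a₀ ha₀ hla₀, hak, LinearMap.zero_apply]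
  obtain ⟨n, hn'⟩ : ∃ n, n = br x₀ v₀ - v₀ := ⟨_, rfl⟩
  rw [← hn'] at hnx
  have hxv : br x₀ v₀ = v₀ + n := by rw [hn']; abel
  have ham : ∀ a, ω a = 0 → l a = 0 → br a v₀ = l n • a := by
    intro a ha hla
    have e := W a ha hla v₀
    have hm := hA a ha hla
    rw [hxv, map_add, hl x₀ _ hx hm, hl a n ha hnx, hla, hlx] at e
    have e' := congrArg l e
    simp only [map_sub, map_add, map_smul, hla, hlx, smul_eq_mul] at e'
    have lm : l (br a v₀) = 0 :=
      (mul_eq_zero.mp (by linear_combination e' : 2 * l (br a v₀) = 0)).resolve_left h2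
    rw [lm] at e
    linear_combination (norm := module) e
  -- Each a in the abelian part has [a,v₀] = l(n)a and [a,x₀] = -a, so this correction makes it
  -- commute with y.
  refine ⟨v₀ + l n • x₀, ?_, ?_, ?_, ?_⟩
  · rw [map_add, map_smul, hx, smul_zero, add_zero]
    intro h
    exact hs (by rw [h, LinearMap.zero_apply])
  · intro a ha hla
    rw [map_add, map_smul, ham a ha hla, hL.swap a x₀, hxa a ha hla]
    module
  · rw [map_add, map_smul, hxv, hL.bracket_self]
    simp [hx, hnx]
  · rw [map_add, map_smul, hxv, hL.bracket_self]
    simp [hlx]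

end IsOmegaLieAlgebra

end RankTwo

/-! ### Degenerate cases, and assembling the listed subalgebras. -/

section Structure

variable {br : L →ₗ[K] L →ₗ[K] L} {ω : L →ₗ[K] L →ₗ[K] K}

namespace IsOmegaLieAlgebra

/-- Jacobi for x, x, z has zero left side, so ω(x,x)z lies in Kx; take z outside Kx. -/
lemma omega_self [FiniteDimensional K L] (hL : IsOmegaLieAlgebra br ω)
    (hn : 2 ≤ Module.finrank K L) (x : L) : ω x x = 0 := by
  obtain ⟨z, -, hz⟩ := exists_mem_notMem_span (N := (⊤ : Submodule K L))
    (by rwa [finrank_top]) x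
  have j := hL.omega_jacobi x x z
  rw [hL.bracket_self, hL.swap x z] at j
  simp only [map_zero, map_neg, LinearMap.zero_apply, LinearMap.neg_apply, zero_add,
    add_neg_cancel] at j
  by_contra hne
  refine hz ((ω x x)⁻¹ * (-(ω z x) - ω x z)) ?_
  have e : ω x x • z = (-(ω z x) - ω x z) • x := by linear_combination (norm := module) -j
  rw [mul_smul, ← e, smul_smul, inv_mul_cancel₀ hne, one_smul]

/-- An `ω`-Lie algebra of dimension at most `2` is a Lie algebra. -/
lemma isLieAlgebra_of_finrank_le_two [FiniteDimensional K L] (hL : IsOmegaLieAlgebra br ω)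
    (hn : Module.finrank K L ≤ 2) : IsLieAlgebra br := by
  refine ⟨fun _ _ _ _ => trivial, fun x _ => hL.bracket_self x, fun x _ y _ z _ => ?_⟩
  obtain ⟨c, hc, hc0⟩ : ∃ c : Fin 3 → K, c 0 • x + c 1 • y + c 2 • z = 0 ∧ c ≠ 0 := by
    let f : (Fin 3 → K) →ₗ[K] L :=
      (LinearMap.proj 0 : (Fin 3 → K) →ₗ[K] K).smulRight x
        + (LinearMap.proj 1 : (Fin 3 → K) →ₗ[K] K).smulRight y
        + (LinearMap.proj 2 : (Fin 3 → K) →ₗ[K] K).smulRight z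
    have h : LinearMap.ker f ≠ ⊥ := LinearMap.ker_ne_bot_of_finrank_lt (by simp; omega)
    obtain ⟨c, hc, hc0⟩ := Submodule.exists_mem_ne_zero_of_ne_bot h
    exact ⟨c, hc, hc0⟩
  have solve : ∀ {a : K} {p q : L}, a ≠ 0 → a • p + q = 0 → p = (-a⁻¹) • q := by
    intro a p q ha h
    rw [eq_neg_of_add_eq_zero_right h, smul_neg, neg_smul, neg_neg, smul_smul,
      inv_mul_cancel₀ ha, one_smul]
  -- Anticommutativity alone gives Jacobi for linearly dependent arguments.
  have dep : ∀ (y z : L) (b c : K), br (br (b • y + c • z) y) z + br (br z (b • y + c • z)) y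
      + br (br y z) (b • y + c • z) = 0 := by
    intro y z b c
    simp only [map_add, map_smul, LinearMap.add_apply, LinearMap.smul_apply, hL.bracket_self,
      smul_zero, add_zero, zero_add]
    rw [hL.swap z y]
    simp only [map_neg, LinearMap.neg_apply]
    module
  have hi : ∃ i, c i ≠ 0 := by
    by_contra! hall
    exact hc0 (funext hall)
  obtain ⟨i, hi⟩ := hi
  fin_cases i
  · have h : c 0 • x + (c 1 • y + c 2 • z) = 0 := by
      linear_combination (norm := module) hc
    have e := solve (a := c 0) hi h
    rw [smul_add, smul_smul, smul_smul] at e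
    rw [e]
    exact dep y z _ _
  · have h : c 1 • y + (c 2 • z + c 0 • x) = 0 := by
      linear_combination (norm := module) hc
    have e := solve (a := c 1) hi h
    rw [smul_add, smul_smul, smul_smul] at e
    rw [e]
    linear_combination (norm := abel) dep z x (-(c 1)⁻¹ * c 2) (-(c 1)⁻¹ * c 0)
  · have h : c 2 • z + (c 0 • x + c 1 • y) = 0 := by
      linear_combination (norm := module) hc
    have e := solve (a := c 2) hi h
    rw [smul_add, smul_smul, smul_smul] at e
    rw [e]
    linear_combination (norm := abel) dep x y (-(c 2)⁻¹ * c 0) (-(c 2)⁻¹ * c 1)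

lemma isLieAlgebra_of_omega_eq_zero (hL : IsOmegaLieAlgebra br ω) (h : ω = 0) :
    IsLieAlgebra br := by
  refine ⟨fun _ _ _ _ => trivial, fun x _ => hL.bracket_self x, fun x _ y _ z _ => ?_⟩
  have j := hL.omega_jacobi x y z
  simpa [h] using j

lemma isLieSubalgebra_of_isotropic (hL : IsOmegaLieAlgebra br ω) {S : Submodule K L}
    (hS : IsSubalgebra br S) (h : ∀ x ∈ S, ∀ y ∈ S, ω x y = 0) : IsLieSubalgebra br S := by
  refine ⟨hS, fun x _ => hL.bracket_self x, fun x hx y hy z hz => ?_⟩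
  have j := hL.omega_jacobi x y z
  rwa [h x hx y hy, h z hz x hx, h y hy z hz, zero_smul, zero_smul, zero_smul, add_zero,
    add_zero] at j

end IsOmegaLieAlgebra

lemma RankLETwo.ker_sup_span (hR : RankLETwo ω) (hω : ∀ x, ω x x = 0) {y : L} (hy : ω y ≠ 0) :
    LinearMap.ker ω ⊔ Submodule.span K {y} = LinearMap.ker (ω.flip y) := by
  apply le_antisymm
  · rw [sup_le_iff, Submodule.span_singleton_le_iff_mem]
    refine ⟨fun z hz => ?_, hω y⟩
    have hz : ω z = 0 := hz
    change ω z y = 0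
    rw [hz, LinearMap.zero_apply]
  · intro w hw
    have hw : ω w y = 0 := hw
    obtain ⟨x, hx⟩ : ∃ x, ω y x ≠ 0 := by
      by_contra! hcon
      exact hy (LinearMap.ext hcon)
    have e := hR.sub_mem_ker hω hx w
    rw [hw, zero_div, zero_smul, sub_zero] at e
    refine Submodule.mem_sup.mpr ⟨_, e, (ω w x / ω y x) • y,
      Submodule.smul_mem _ _ (Submodule.mem_span_singleton_self y), ?_⟩
    abel

/-- The sum `M` of the kernel of `ω` and a line normalizing it modulo that line is a Lie subalgebra
of codimension `1`, and the forms `α` on `M` all have the kernel of `ω` as their kernel. -/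
lemma IsOmegaLieAlgebra.codim_one_subalgebra [FiniteDimensional K L]
    (hL : IsOmegaLieAlgebra br ω) (hω : ∀ x, ω x x = 0) (h2 : (2 : K) ≠ 0) (hR : RankLETwo ω)
    {y : L} (hy : ω y ≠ 0)
    (hnorm : ∀ z, ω z = 0 → br z y ∈ LinearMap.ker ω ⊔ Submodule.span K {y})
    (htype : TypeA br (LinearMap.ker ω ⊔ Submodule.span K {y}) (LinearMap.ker ω) ∨
      TypeD br (LinearMap.ker ω ⊔ Submodule.span K {y}) (LinearMap.ker ω)) :
    ∃ M : Submodule K L, IsLieSubalgebra br M ∧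
      Module.finrank K M + 1 = Module.finrank K L ∧
      ∀ v : L, v ∉ M → IsListed br M (alphaKer ω M v) := by
  have hM := hR.ker_sup_span hω hy
  have hkl : ∀ z ∈ LinearMap.ker ω, ∀ w, ω z w = 0 := fun z hz w => by
    rw [LinearMap.mem_ker.mp hz, LinearMap.zero_apply]
  have hkr : ∀ z ∈ LinearMap.ker ω, ∀ w, ω w z = 0 := fun z hz w => by
    rw [omega_swap hω, hkl z hz, neg_zero]
  have hsub : IsSubalgebra br (LinearMap.ker ω) := fun z hz t ht =>
    hL.omega_bracket_ker hω h2 hz ht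
  have hrank : Module.finrank K ↥(LinearMap.ker ω ⊔ Submodule.span K {y}) + 1
      = Module.finrank K L := by
    have hne : ω.flip y ≠ 0 := fun h => hy (LinearMap.ext fun w => by
      rw [omega_swap hω, ← LinearMap.flip_apply, h, LinearMap.zero_apply, neg_zero])
    rw [hM]
    exact Module.Dual.finrank_ker_add_one_of_ne_zero hne
  refine ⟨LinearMap.ker ω ⊔ Submodule.span K {y}, hL.isLieSubalgebra_of_isotropic ?_ ?_, hrank, ?_⟩
  · intro p hp q hq
    obtain ⟨z, hz, _, hc, rfl⟩ := Submodule.mem_sup.mp hp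
    obtain ⟨t, ht, _, hd, rfl⟩ := Submodule.mem_sup.mp hq
    obtain ⟨c, rfl⟩ := Submodule.mem_span_singleton.mp hc
    obtain ⟨d, rfl⟩ := Submodule.mem_span_singleton.mp hd
    have e : br (z + c • y) (t + d • y) = br z t + (d • br z y - c • br t y) := by
      simp only [map_add, map_smul, LinearMap.add_apply, LinearMap.smul_apply, hL.bracket_self,
        hL.swap y t]
      module
    rw [e]
    exact Submodule.add_mem _ (Submodule.mem_sup_left (hsub z hz t ht))
      (Submodule.sub_mem _ (Submodule.smul_mem _ _ (hnorm z hz))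
        (Submodule.smul_mem _ _ (hnorm t ht)))
  · intro p hp q hq
    obtain ⟨z, hz, _, hc, rfl⟩ := Submodule.mem_sup.mp hp
    obtain ⟨t, ht, _, hd, rfl⟩ := Submodule.mem_sup.mp hq
    obtain ⟨c, rfl⟩ := Submodule.mem_span_singleton.mp hc
    obtain ⟨d, rfl⟩ := Submodule.mem_span_singleton.mp hd
    simp [hkl z hz, hkr t ht, hω]
  · intro v hv
    -- The subalgebra is exactly the orthogonal complement of y.
    have hyv : ω y v ≠ 0 := fun h => hv (by
      rw [hM]
      change ω v y = 0
      rw [omega_swap hω, h, neg_zero])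
    have hα : alphaKer ω (LinearMap.ker ω ⊔ Submodule.span K {y}) v = LinearMap.ker ω := by
      apply le_antisymm
      · rintro p ⟨hp, hpv⟩
        have hpv : ω p v = 0 := hpv
        obtain ⟨z, hz, _, hc, rfl⟩ := Submodule.mem_sup.mp hp
        obtain ⟨c, rfl⟩ := Submodule.mem_span_singleton.mp hc
        rw [map_add, LinearMap.add_apply, hkl z hz, zero_add, map_smul, LinearMap.smul_apply,
          smul_eq_mul] at hpv
        rw [(mul_eq_zero.mp hpv).resolve_right hyv, zero_smul, add_zero]
        exact hz
      · exact fun z hz => ⟨Submodule.mem_sup_left hz, hkl z hz v⟩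
    rw [hα]
    refine ⟨hsub, ?_, ?_⟩
    · have := hR.finrank_ker hω hyv
      omega
    · exact htype.elim Or.inl (fun h => Or.inr (Or.inr (Or.inr h)))

lemma IsOmegaLieAlgebra.structure_of_abelian_ker [FiniteDimensional K L]
    (hL : IsOmegaLieAlgebra br ω) (hω : ∀ x, ω x x = 0) (h2 : (2 : K) ≠ 0) (hR : RankLETwo ω)
    (hN : 2 ≤ Module.finrank K (LinearMap.ker ω)) {u v : L} (huv : ω u v ≠ 0)
    (hab : ∀ z t, ω z = 0 → ω t = 0 → br z t = 0) :
    ∃ M : Submodule K L, IsLieSubalgebra br M ∧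
      Module.finrank K M + 1 = Module.finrank K L ∧
      ∀ v : L, v ∉ M → IsListed br M (alphaKer ω M v) := by
  obtain ⟨y, hy, hyN⟩ := hL.exists_normalizer_of_abelian_ker hω h2 hR hN huv hab
  refine hL.codim_one_subalgebra hω h2 hR hy (fun z hz => Submodule.mem_sup_left (hyN z hz)) ?_
  exact Or.inl ⟨LinearMap.ker ω, y, hy, rfl, fun z hz t ht => hab z t hz ht, hyN, rfl⟩

/-- The case of a nonabelian kernel, with `l` the linear form describing its product. -/
lemma IsOmegaLieAlgebra.structure_of_nonabelian_ker [FiniteDimensional K L]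
    (hL : IsOmegaLieAlgebra br ω) (hω : ∀ x, ω x x = 0) (h2 : (2 : K) ≠ 0) (hR : RankLETwo ω)
    {u v : L} (huv : ω u v ≠ 0) (l : L →ₗ[K] K)
    (hl : ∀ z t, ω z = 0 → ω t = 0 → br z t = l z • t - l t • z)
    {x₀ : L} (hx : ω x₀ = 0) (hlx : l x₀ = 1) :
    (∃ M : Submodule K L, IsLieSubalgebra br M ∧
      Module.finrank K M + 1 = Module.finrank K L ∧
      ∀ v : L, v ∉ M → IsListed br M (alphaKer ω M v)) ∨
    (Module.finrank K (LinearMap.ker ω) + 2 = Module.finrank K L ∧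
      ∃ A : Submodule K L, IsAlmostAbelianWithPart br (LinearMap.ker ω) A ∧
        ∀ a ∈ A, IsNilpotent (ad br a)) := by
  have hab : IsAbelian br (LinearMap.ker ω ⊓ LinearMap.ker l) := by
    rintro a ⟨ha, hla⟩ b ⟨hb, hlb⟩
    rw [hl a b ha hb, LinearMap.mem_ker.mp hla, LinearMap.mem_ker.mp hlb, zero_smul, zero_smul,
      sub_zero]
  -- The sign appears because `ad` is right multiplication while `l` describes left multiplication
  -- by x₀.
  have hxA : -x₀ ∉ LinearMap.ker ω ⊓ LinearMap.ker l := by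
    rintro ⟨-, h⟩
    have h : l (-x₀) = 0 := h
    rw [map_neg, hlx, neg_eq_zero] at h
    exact one_ne_zero h
  have had : ∀ a ∈ LinearMap.ker ω ⊓ LinearMap.ker l, ad br (-x₀) a = a := by
    rintro a ⟨ha, hla⟩
    change br a (-x₀) = a
    rw [map_neg, hl a x₀ ha hx, LinearMap.mem_ker.mp hla, hlx, zero_smul, zero_sub, neg_neg,
      one_smul]
  have hN : LinearMap.ker ω = LinearMap.ker ω ⊓ LinearMap.ker l ⊔ Submodule.span K {-x₀} := by
    apply le_antisymm
    · intro z hz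
      refine Submodule.mem_sup.mpr ⟨z - l z • x₀, ⟨?_, ?_⟩, (-l z) • -x₀,
        Submodule.smul_mem _ _ (Submodule.mem_span_singleton_self _), ?_⟩
      · exact Submodule.sub_mem _ hz (Submodule.smul_mem _ _ hx)
      · simp [hlx]
      · module
    · rw [sup_le_iff, Submodule.span_singleton_le_iff_mem]
      exact ⟨inf_le_left, Submodule.neg_mem _ hx⟩
  by_cases hact : ∃ a₀, ω a₀ = 0 ∧ l a₀ = 0 ∧ ∃ w₀, ω (br a₀ w₀) ≠ 0
  · left
    obtain ⟨a₀, ha₀, hla₀, w₀, hw₀⟩ := hact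
    obtain ⟨y, hy, hay, hxy, hlxy⟩ :=
      hL.exists_centralizer_of_nonabelian_ker hω h2 hR l hl hx hlx ha₀ hla₀ hw₀
    refine hL.codim_one_subalgebra hω h2 hR hy (fun z hz => ?_) (Or.inr ?_)
    · have e : br z y = l z • (br x₀ y - y) + l z • y := by
        have h0 := hay (z - l z • x₀) (by rw [map_sub, map_smul, hz, hx, smul_zero, sub_zero])
          (by simp [hlx])
        rw [map_sub, map_smul, LinearMap.sub_apply, LinearMap.smul_apply] at h0
        linear_combination (norm := module) h0
      rw [e]
      exact Submodule.add_mem_sup (Submodule.smul_mem _ _ hxy)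
        (Submodule.smul_mem _ _ (Submodule.mem_span_singleton_self y))
    · refine ⟨LinearMap.ker ω ⊓ LinearMap.ker l, -x₀, y, hxA, ?_, ?_, hab, had, ?_,
        ⟨-(br x₀ y - y), Submodule.neg_mem _ ⟨hxy, hlxy⟩, -1, ?_, ?_⟩, hN⟩
      · rw [← hN]
        exact hy
      · rw [← hN]
      · exact fun a ha => hay a ha.1 ha.2
      · exact neg_ne_zero.mpr one_ne_zero
      · rw [map_neg, LinearMap.neg_apply]
        module
  · right
    push Not at hact
    refine ⟨hR.finrank_ker hω huv, LinearMap.ker ω ⊓ LinearMap.ker l,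
      ⟨hL.isLieSubalgebra_of_isotropic (fun z hz t ht => hL.omega_bracket_ker hω h2 hz ht) ?_,
        hab, -x₀, hxA, hN, had⟩, ?_⟩
    · intro z hz w _
      rw [LinearMap.mem_ker.mp hz, LinearMap.zero_apply]
    · rintro a ⟨ha, hla⟩
      have ha : ω a = 0 := ha
      have hla : l a = 0 := hla
      -- One application of ad a lands in Ker ω, the second in Ka, and the third gives zero.
      refine ⟨3, LinearMap.ext fun w => ?_⟩
      change br (br (br w a) a) a = 0
      have hw : ω (br w a) = 0 := by
        rw [hL.swap w a, map_neg, hact a ha hla w, neg_zero]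
      rw [hl _ a hw ha, hla, zero_smul, sub_zero, map_smul, LinearMap.smul_apply,
        hL.bracket_self, smul_zero]

end Structure

end OmegaLie

/-! ### The classification. -/

theorem theorem9p1 {K L : Type*} [Field K] (h2 : ringChar K ≠ 2) (h3 : ringChar K ≠ 3)
    [AddCommGroup L] [Module K L] [FiniteDimensional K L]
    (br : L →ₗ[K] L →ₗ[K] L) (ω : L →ₗ[K] L →ₗ[K] K)
    (hL : OmegaLie.IsOmegaLieAlgebra br ω) (hnotLie : ¬ OmegaLie.IsLieAlgebra br) :
    (Module.finrank K L = 3 ∨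
      (∃ M : Submodule K L, OmegaLie.IsLieSubalgebra br M ∧
        Module.finrank K M + 1 = Module.finrank K L ∧
        ∀ v : L, v ∉ M → OmegaLie.IsListed br M (OmegaLie.alphaKer ω M v)) ∨
      (Module.finrank K (LinearMap.ker ω) + 2 = Module.finrank K L ∧
        ∃ A : Submodule K L, OmegaLie.IsAlmostAbelianWithPart br (LinearMap.ker ω) A ∧
          ∀ a ∈ A, IsNilpotent (OmegaLie.ad br a))) ∧
    (∃ B : Submodule K L, OmegaLie.IsAbelian br B ∧
      Module.finrank K L ≤ Module.finrank K B + 3) := by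
  have two : (2 : K) ≠ 0 := Ring.two_ne_zero h2
  have three : (3 : K) ≠ 0 := by
    intro h
    have hd : ringChar K ∣ 3 := (ringChar.spec K 3).mp (by exact_mod_cast h)
    rcases (Nat.dvd_prime Nat.prime_three).mp hd with h1 | h1
    · exact CharP.ringChar_ne_one h1
    · exact h3 h1
  have hn3 : 3 ≤ Module.finrank K L := by
    by_contra hlt
    exact hnotLie (hL.isLieAlgebra_of_finrank_le_two (by omega))
  rcases hn3.eq_or_lt with hn | hn
  · refine ⟨Or.inl hn.symm, ⊥, fun x hx y _ => ?_, by omega⟩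
    rw [(Submodule.mem_bot K).mp hx, map_zero, LinearMap.zero_apply]
  have hω := hL.omega_self (by omega)
  have hR := hL.rankLETwo hω two three (by omega)
  obtain ⟨u, v, huv⟩ : ∃ u v, ω u v ≠ 0 := by
    by_contra! hcon
    exact hnotLie (hL.isLieAlgebra_of_omega_eq_zero (LinearMap.ext₂ hcon))
  have hrank := hR.finrank_ker hω huv
  by_cases hab : ∀ z t, ω z = 0 → ω t = 0 → br z t = 0
  · exact ⟨Or.inr (Or.inl (hL.structure_of_abelian_ker hω two hR (by omega) huv hab)),
      LinearMap.ker ω, fun z hz t ht => hab z t hz ht, by omega⟩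
  -- The form is l = dω(u,v,·)/ω(u,v).
  obtain ⟨l, hl⟩ : ∃ l : L →ₗ[K] K, ∀ z t, ω z = 0 → ω t = 0 → br z t = l z • t - l t • z := by
    refine ⟨(ω u v)⁻¹ • (ω (br u v) + ω.flip v ∘ₗ br.flip u + ω.flip u ∘ₗ br v),
      fun z t hz ht => ?_⟩
    have e := congrArg ((ω u v)⁻¹ • ·) (hL.bracket_ker hω two hz ht u v)
    simp only [smul_smul, smul_sub, inv_mul_cancel₀ huv, one_smul] at e
    exact e
  obtain ⟨x, hx, hlx⟩ : ∃ x, ω x = 0 ∧ l x = 1 := by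
    obtain ⟨z, hz, hlz⟩ : ∃ z, ω z = 0 ∧ l z ≠ 0 := by
      by_contra! hcon
      refine hab fun z t hz ht => ?_
      rw [hl z t hz ht, hcon z hz, hcon t ht, zero_smul, zero_smul, sub_zero]
    exact ⟨(l z)⁻¹ • z, by rw [map_smul, hz, smul_zero],
      by rw [map_smul, smul_eq_mul, inv_mul_cancel₀ hlz]⟩
  refine ⟨Or.inr (hL.structure_of_nonabelian_ker hω two hR huv l hl hx hlx),
    LinearMap.ker ω ⊓ LinearMap.ker l, ?_, ?_⟩
  · rintro a ⟨ha, hla⟩ b ⟨hb, hlb⟩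
    rw [hl a b ha hb, LinearMap.mem_ker.mp hla, LinearMap.mem_ker.mp hlb, zero_smul, zero_smul,
      sub_zero]
  · have hl0 : l ≠ 0 := by
      rintro rfl
      simp at hlx
    have h1 : Module.finrank K (LinearMap.ker l) + 1 = Module.finrank K L :=
      Module.Dual.finrank_ker_add_one_of_ne_zero hl0
    have hsum := Submodule.finrank_sup_add_finrank_inf_eq (LinearMap.ker ω) (LinearMap.ker l)
    have hle := Submodule.finrank_le (LinearMap.ker ω ⊔ LinearMap.ker l)
    omega
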